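/- Let $X$ be a finite set and let $\trianglerighteq$ be a linear order on $X$. A preference is a linear order (complete, transitive, antisymmetric) $\succ$ on $X$; let $\mathcal{L}$ be the set of preferences, $\Delta(\mathcal{L})$ the set of probability distributions on $\mathcal{L}$, and let $x^k_i$ denote the $k$-th most preferred alternative of $\succ_i$. A random choice rule is a function $\rho$ assigning to each $x\in X$ and each non-empty $A\subseteq X$ a number $\rho(x,A)\in[0,1]$ such that $\sum_{x\in A}\rho(x,A)=1$ for every non-empty $A\subseteq X$. A distribution $\mu\in\Delta(\mathcal{L})$ rationalizes $\rho$ if $\rho(x,A)=\mu\{\succ\;:\; x \text{ is the } \succ\text{-best element of } A\}$ for all $x\in A\subseteq X$. Call $\mu\in\Delta(\mathcal{L})$: - single-crossing if $\operatorname{supp}(\mu)$ can be ordered $\succ_1,\dots,\succ_N$ so that whenever $x\trianglerighteq y$, $x\succ_j y$ and $i>j$, also $x\succ_i y$; - progressive if the set of choice functions on non-empty subsets of $X$ induced by the preferences in $\operatorname{supp}(\mu)$ (each choosing the best element of every menu), i.e. the support of the induced distribution over choice functions, can be ordered $c_1,\dots,c_N$ so that $i>j$ implies $c_i(A)\trianglerighteq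 c_j(A)$ for every non-empty $A\subseteq X$; - swap-progressive if $\operatorname{supp}(\mu)$ can be ordered $\succ_1,\dots,\succ_N$ so that, for all $i>j$ and all $0\le k\le |X|-1$ such that $\succ_i$ and $\succ_j$ have the same set of $k$ best alternatives, $x^{k+1}_i\trianglerighteq x^{k+1}_j$. Then: (i) For every random choice rule $\rho$, there exists a swap-progressive $\mu\in\Delta(\mathcal{L})$ that rationalizes $\rho$ if and only if there exists some $\mu\in\Delta(\mathcal{L})$ that rationalizes $\rho$. Moreover, if such a swap-progressive $\mu$ exists, it is unique. (ii) Every single-crossing $\mu\in\Delta(\mathcal{L})$ is swap-progressive. Conversely, a swap-progressive $\mu\in\Delta(\mathcal{L})$ is single-crossing if and only if it is progressive. -/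

import Mathlib

noncomputable section

/-- A preference on `X`: a complete, transitive and antisymmetric binary relation;
`p.rel x y` means that `x` is weakly preferred to `y`. -/
@[ext]
structure Preference (X : Type*) where
  rel : X → X → Prop
  total : ∀ x y, rel x y ∨ rel y x
  trans : ∀ x y z, rel x y → rel y z → rel x z
  antisymm : ∀ x y, rel x y → rel y x → x = y

/-- The menus: non-empty finite sets of alternatives. -/
abbrev Menu (X : Type*) := {A : Finset X // A.Nonempty}

/-- A (deterministic) choice function: it picks an element of every menu. -/
abbrev ChoiceFunction (X : Type*) := {c : Menu X → X // ∀ A, c A ∈ A.1}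

namespace Preference

variable {X : Type*}

instance [Finite X] : Finite (Preference X) :=
  Finite.of_injective (fun p : Preference X => p.rel) fun _ _ h => Preference.ext h

instance [Finite X] : Fintype (Preference X) := Fintype.ofFinite _

theorem refl (p : Preference X) (x : X) : p.rel x x := (p.total x x).elim id id

/-- `x` is the best (most preferred) element of `A`. -/
def IsBest (p : Preference X) (A : Finset X) (x : X) : Prop :=
  x ∈ A ∧ ∀ y ∈ A, p.rel x y

variable [Fintype X]

open Classical in
/-- The number of alternatives strictly preferred to `x`. -/
def rank (p : Preference X) (x : X) : ℕ :=
  (Finset.univ.filter fun y => y ≠ x ∧ p.rel y x).card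

theorem rank_lt_rank (p : Preference X) {x y : X} (hne : x ≠ y) (h : p.rel x y) :
    p.rank x < p.rank y := by
  classical
  apply Finset.card_lt_card
  rw [Finset.ssubset_iff_of_subset]
  · exact ⟨x, by simp [hne, h], by simp⟩
  · intro z hz
    simp only [Finset.mem_filter, Finset.mem_univ, true_and] at hz ⊢
    refine ⟨?_, p.trans _ _ _ hz.2 h⟩
    rintro rfl
    exact hne (p.antisymm _ _ h hz.2)

theorem rank_injective (p : Preference X) : Function.Injective p.rank := by
  intro x y h
  by_contra hne
  rcases p.total x y with hxy | hyx
  · exact absurd h (p.rank_lt_rank hne hxy).ne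
  · exact absurd h (p.rank_lt_rank (Ne.symm hne) hyx).ne'

theorem rank_lt_card (p : Preference X) (x : X) : p.rank x < Fintype.card X := by
  classical
  exact Finset.card_lt_univ_of_notMem (x := x) (by simp)

/-- Alternatives in bijection with positions `0, …, |X| - 1`, position `0` being the best. -/
def rankEquiv (p : Preference X) : X ≃ Fin (Fintype.card X) :=
  Equiv.ofBijective (fun x => (⟨p.rank x, p.rank_lt_card x⟩ : Fin (Fintype.card X)))
    ((Fintype.bijective_iff_injective_and_card _).2
      ⟨fun _ _ h => p.rank_injective (Fin.mk.inj h), by simp⟩)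

/-- `p.nth k` is the alternative with exactly `k` strictly better ones, i.e. the `(k+1)`-th most
preferred alternative. -/
def nth (p : Preference X) (k : Fin (Fintype.card X)) : X := p.rankEquiv.symm k

open Classical in
/-- The set of the `k` most preferred alternatives. -/
def topSet (p : Preference X) (k : ℕ) : Finset X :=
  Finset.univ.filter fun x => p.rank x < k

/-- `k`-compatibility: both preferences have the same set of `k` best alternatives. -/
def Compatible (k : ℕ) (p q : Preference X) : Prop := p.topSet k = q.topSet k

theorem exists_isBest (p : Preference X) (A : Menu X) : ∃ x, p.IsBest A.1 x := by
  obtain ⟨x, hx, hmin⟩ := A.1.exists_min_image p.rank A.2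
  refine ⟨x, hx, fun y hy => ?_⟩
  rcases p.total x y with h | h
  · exact h
  · by_cases hxy : y = x
    · exact hxy ▸ p.refl y
    · exact absurd (p.rank_lt_rank hxy h) (not_lt.2 (hmin y hy))

/-- The choice function that picks the best alternative of every menu. -/
def toChoice (p : Preference X) : ChoiceFunction X :=
  ⟨fun A => (p.exists_isBest A).choose, fun A => (p.exists_isBest A).choose_spec.1⟩

end Preference

instance {X : Type*} [Fintype X] : Fintype (ChoiceFunction X) := Fintype.ofFinite _

/-- A random choice rule: numbers `prob x A ∈ [0,1]` with `∑ x ∈ A, prob x A = 1` for every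
menu `A`. -/
structure RandomChoiceRule (X : Type*) where
  prob : X → Menu X → ℝ
  prob_mem : ∀ x A, prob x A ∈ Set.Icc (0 : ℝ) 1
  sum_eq_one : ∀ A : Menu X, ∑ x ∈ A.1, prob x A = 1

section Representations

variable {X : Type*} [Fintype X]

open Classical in
/-- `μ`, a probability distribution over preferences, rationalizes `ρ`: for all `x ∈ A`, the
number `ρ(x, A)` is the probability that `x` is the best element of `A`. -/
def Rationalizes (μ : stdSimplex ℝ (Preference X)) (ρ : RandomChoiceRule X) : Prop :=
  ∀ A : Menu X, ∀ x ∈ A.1,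
    ρ.prob x A = ∑ p ∈ Finset.univ.filter (fun p : Preference X => p.IsBest A.1 x), μ p

/-- `e 0, …, e (N-1)` lists the support of `μ` without repetition. -/
def ListsSupport {α : Type*} [Fintype α] (μ : stdSimplex ℝ α) {N : ℕ} (e : Fin N → α) : Prop :=
  Function.Injective e ∧ Set.range e = {a | μ a ≠ 0}

/-- Single-crossing distributions over preferences. Here and below `y ≤ x` is the exogenous linear
order on alternatives (`x` is ranked
weakly above `y`). -/
def SingleCrossing [LinearOrder X] (μ : stdSimplex ℝ (Preference X)) : Prop :=
  ∃ (N : ℕ) (e : Fin N → Preference X), ListsSupport μ e ∧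
    ∀ i j, j < i → ∀ x y : X, y ≤ x → (e j).rel x y → (e i).rel x y

/-- Progressive distributions over choice functions. -/
def Progressive [LinearOrder X] (ν : stdSimplex ℝ (ChoiceFunction X)) : Prop :=
  ∃ (N : ℕ) (c : Fin N → ChoiceFunction X), ListsSupport ν c ∧
    ∀ i j, j < i → ∀ A : Menu X, (c j).1 A ≤ (c i).1 A

/-- The distribution over choice functions induced by a distribution over preferences. -/
def inducedChoice (μ : stdSimplex ℝ (Preference X)) : stdSimplex ℝ (ChoiceFunction X) :=
  stdSimplex.map Preference.toChoice μ

/-- Swap-progressive distributions over preferences. -/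
def SwapProgressive [LinearOrder X] (μ : stdSimplex ℝ (Preference X)) : Prop :=
  ∃ (N : ℕ) (e : Fin N → Preference X), ListsSupport μ e ∧
    ∀ i j, j < i → ∀ k : Fin (Fintype.card X),
      Preference.Compatible (k : ℕ) (e i) (e j) → (e j).nth k ≤ (e i).nth k

end Representations

end

/-! ### Ranks, positions and top sets. -/

namespace Preference

variable {X : Type*} [Fintype X]

/-! Read a preference as the word of heights of its successive alternatives. Any swap-progressive
listing of the support must be lexicographic, so the property can be tested on pairs: if two
supported preferences share a top set, the one with the smaller prefix must not continue higher
(`swapProgressive_iff_noncrossing`).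

Existence is a maximization. The distributions rationalizing `ρ` form a compact set; take one that
maximizes the expected squared lexicographic code. If two supported preferences crossed at a common
top set, exchanging their tails for a little mass would leave all choice probabilities unchanged,
while the two codes would spread apart with the same sum, contradicting maximality
(`code_sq_lt_splice`, `exists_transfer`).

Uniqueness is an induction on prefix length. `ρ` determines the probability that `D` is the set of
alternatives above `x`, by inversion over subsets (`mass_topSet_rank_eq`). Given a top set, this is
the law of the next alternative; the law of the prefix is known by induction. Noncrossing makes the
two comonotone, so their joint distribution function is the minimum of the marginal ones, and the
law of the longer prefix follows (`mass_code_eq`).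

For the second part, two-element menus translate single-crossing into progressivity, and comparing
the first alternatives after a common top set gives swap-progressivity. -/

theorem rel_iff_rank_le (p : Preference X) (x y : X) : p.rel x y ↔ p.rank x ≤ p.rank y := by
  constructor
  · intro h
    by_cases hxy : x = y
    · rw [hxy]
    · exact (p.rank_lt_rank hxy h).le
  · intro h
    rcases p.total x y with hxy | hyx
    · exact hxy
    · by_cases hne : y = x
      · exact hne ▸ p.refl y
      · exact absurd (p.rank_lt_rank hne hyx) (not_lt.2 h)

theorem mem_topSet (p : Preference X) (k : ℕ) (x : X) : x ∈ p.topSet k ↔ p.rank x < k := by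
  simp [topSet]

theorem rank_nth (p : Preference X) (k : Fin (Fintype.card X)) : p.rank (p.nth k) = k := by
  have h := congrArg Fin.val (p.rankEquiv.apply_symm_apply k)
  exact h

theorem nth_rank (p : Preference X) (x : X) : p.nth ⟨p.rank x, p.rank_lt_card x⟩ = x :=
  p.rank_injective (p.rank_nth _)

theorem nth_eq_iff (p : Preference X) (k : Fin (Fintype.card X)) (x : X) :
    p.nth k = x ↔ p.rank x = k := by
  constructor
  · rintro rfl
    exact p.rank_nth k
  · intro h
    exact p.rank_injective ((p.rank_nth k).trans h.symm)

theorem ext_rank {p q : Preference X} (h : ∀ x, p.rank x = q.rank x) : p = q := by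
  ext x y
  rw [rel_iff_rank_le, rel_iff_rank_le, h, h]

theorem card_topSet_rank (p : Preference X) (x : X) : (p.topSet (p.rank x)).card = p.rank x := by
  classical
  conv_rhs => rw [rank]
  congr 1
  ext y
  rw [mem_topSet]
  simp only [Finset.mem_filter, Finset.mem_univ, true_and]
  constructor
  · intro h
    refine ⟨?_, (p.rel_iff_rank_le _ _).2 h.le⟩
    rintro rfl
    exact lt_irrefl _ h
  · rintro ⟨hne, h⟩
    exact p.rank_lt_rank hne h

theorem card_topSet (p : Preference X) (k : Fin (Fintype.card X)) : (p.topSet k).card = k := by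
  have h := p.card_topSet_rank (p.nth k)
  rwa [rank_nth] at h

/-- The cardinality of the common top set forces the rank of `x` to be `k`. -/
theorem topSet_rank_eq_iff (p q : Preference X) (k : Fin (Fintype.card X)) (x : X) :
    p.topSet (p.rank x) = q.topSet k ↔ p.topSet k = q.topSet k ∧ p.nth k = x := by
  constructor
  · intro h
    have hr : p.rank x = k := by
      rw [← card_topSet_rank, h, card_topSet]
    exact ⟨hr ▸ h, (p.nth_eq_iff k x).2 hr⟩
  · rintro ⟨h, hx⟩
    rw [(p.nth_eq_iff k x).1 hx, h]

theorem isBest_iff (p : Preference X) (A : Finset X) (x : X) :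
    p.IsBest A x ↔ x ∈ A ∧ ∀ y ∈ A, y ∉ p.topSet (p.rank x) := by
  simp only [IsBest, rel_iff_rank_le, mem_topSet, not_lt]

/-! ### Exchanging tails at a common top set, and its effect on choices. -/

open Classical in
/-- The preference that agrees with `p` on `D` and with `q` off `D`, with `D` on top. -/
def splice (D : Finset X) (p q : Preference X) : Preference X where
  rel x y := if x ∈ D then (y ∈ D → p.rel x y) else (y ∉ D ∧ q.rel x y)
  total x y := by
    by_cases hx : x ∈ D <;> by_cases hy : y ∈ D <;> simp [hx, hy, p.total, q.total]
  trans x y z := by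
    by_cases hx : x ∈ D <;> by_cases hy : y ∈ D <;> by_cases hz : z ∈ D <;> simp [hx, hy, hz]
    · exact p.trans x y z
    · exact q.trans x y z
  antisymm x y := by
    by_cases hx : x ∈ D <;> by_cases hy : y ∈ D <;> simp [hx, hy]
    · exact p.antisymm x y
    · exact q.antisymm x y

theorem rank_splice_of_mem {p q : Preference X} {k : ℕ} {x : X} (hx : x ∈ p.topSet k) :
    (splice (p.topSet k) p q).rank x = p.rank x := by
  classical
  unfold rank
  congr 1
  ext y
  rw [Finset.mem_filter, Finset.mem_filter]
  refine and_congr_right fun _ => and_congr_right fun _ => ?_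
  simp only [splice]
  by_cases hy : y ∈ p.topSet k
  · simp [hx, hy]
  · simp only [hx, hy, if_false, not_true, false_and, false_iff]
    rw [rel_iff_rank_le]
    rw [mem_topSet] at hx hy
    omega

theorem rank_splice_of_notMem {p q : Preference X} {k : ℕ} {x : X} (h : p.topSet k = q.topSet k)
    (hx : x ∉ p.topSet k) : (splice (p.topSet k) p q).rank x = q.rank x := by
  classical
  unfold rank
  congr 1
  ext y
  rw [Finset.mem_filter, Finset.mem_filter]
  refine and_congr_right fun _ => and_congr_right fun _ => ?_
  simp only [splice]
  by_cases hy : y ∈ p.topSet k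
  · simp only [hx, hy, if_true, false_imp_iff, true_iff]
    rw [h] at hx hy
    rw [rel_iff_rank_le]
    rw [mem_topSet] at hx hy
    omega
  · simp [hx, hy]

theorem nth_splice_of_lt {p q : Preference X} {k : ℕ} {j : Fin (Fintype.card X)}
    (hj : (j : ℕ) < k) : (splice (p.topSet k) p q).nth j = p.nth j := by
  rw [nth_eq_iff, rank_splice_of_mem, rank_nth]
  rwa [mem_topSet, rank_nth]

theorem nth_splice_of_le {p q : Preference X} {k : ℕ} {j : Fin (Fintype.card X)}
    (h : p.topSet k = q.topSet k) (hj : k ≤ (j : ℕ)) :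
    (splice (p.topSet k) p q).nth j = q.nth j := by
  rw [nth_eq_iff, rank_splice_of_notMem h, rank_nth]
  rw [h, mem_topSet, rank_nth]
  omega

theorem isBest_congr_of_rel {Y : Type*} {p q : Preference Y} {A : Finset Y} {x : Y}
    (h : ∀ y, p.rel x y ↔ q.rel x y) : p.IsBest A x ↔ q.IsBest A x := by
  simp only [IsBest, h]

/-- With `isBest_splice_of_notMem`: since the cut is common, the two splices choose `x` from `A`
exactly as often as the two original preferences do. -/
theorem isBest_splice_of_mem {p q : Preference X} {k : ℕ} {A : Finset X} {x : X}
    (hx : x ∈ p.topSet k) : (splice (p.topSet k) p q).IsBest A x ↔ p.IsBest A x := by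
  refine isBest_congr_of_rel fun y => ?_
  simp only [splice, hx, if_true]
  by_cases hy : y ∈ p.topSet k
  · simp [hy]
  · simp only [hy, false_imp_iff, true_iff]
    rw [rel_iff_rank_le]
    rw [mem_topSet] at hx hy
    omega

theorem isBest_splice_of_notMem {p q : Preference X} {k : ℕ} {A : Finset X} {x : X}
    (h : p.topSet k = q.topSet k) (hx : x ∉ p.topSet k) :
    (splice (p.topSet k) p q).IsBest A x ↔ q.IsBest A x := by
  refine isBest_congr_of_rel fun y => ?_
  simp only [splice, hx, if_false, and_iff_right_iff_imp]
  intro hr hy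
  rw [rel_iff_rank_le] at hr
  rw [h, mem_topSet] at hx hy
  omega

theorem isBest_toChoice (p : Preference X) (A : Menu X) : p.IsBest A.1 (p.toChoice.1 A) :=
  (p.exists_isBest A).choose_spec

theorem IsBest.eq {Y : Type*} {p : Preference Y} {A : Finset Y} {x y : Y} (hx : p.IsBest A x)
    (hy : p.IsBest A y) : x = y :=
  p.antisymm _ _ (hx.2 y hy.1) (hy.2 x hx.1)

theorem toChoice_eq_iff (p : Preference X) (A : Menu X) (x : X) :
    p.toChoice.1 A = x ↔ p.IsBest A.1 x :=
  ⟨fun h => h ▸ p.isBest_toChoice A, fun h => (p.isBest_toChoice A).eq h⟩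

open Classical in
/-- The menu consisting of two given alternatives. -/
noncomputable def pair (x y : X) : Menu X := ⟨{x, y}, ⟨x, by simp⟩⟩

theorem toChoice_pair_eq_left_iff (p : Preference X) (x y : X) :
    p.toChoice.1 (pair x y) = x ↔ p.rel x y := by
  rw [toChoice_eq_iff]
  simp [IsBest, pair, p.refl]

theorem toChoice_pair_eq_or (p : Preference X) (x y : X) :
    p.toChoice.1 (pair x y) = x ∨ p.toChoice.1 (pair x y) = y := by
  have h := (p.toChoice.2 (pair x y))
  simpa [pair] using h

theorem toChoice_injective : Function.Injective (toChoice : Preference X → ChoiceFunction X) := by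
  intro p q h
  ext x y
  rw [← toChoice_pair_eq_left_iff, ← toChoice_pair_eq_left_iff, h]

/-! ### Lexicographic codes. -/

section Code

variable [LinearOrder X]

/-- The number of alternatives strictly below `x` in the exogenous order. -/
def height (x : X) : ℕ := (Finset.univ.filter fun y => y < x).card

theorem height_strictMono : StrictMono (height : X → ℕ) := by
  intro x y h
  apply Finset.card_lt_card
  rw [Finset.ssubset_iff_of_subset]
  · exact ⟨x, by simp [h], by simp⟩
  · intro z hz
    simp only [Finset.mem_filter, Finset.mem_univ, true_and] at hz ⊢
    exact hz.trans h

theorem height_le_card (x : X) : height x ≤ Fintype.card X := Finset.card_le_univ _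

/-- The height of the `k`-th alternative (counted from `0`), and `0` beyond the last one. -/
noncomputable def digit (p : Preference X) (k : ℕ) : ℕ :=
  if h : k < Fintype.card X then height (p.nth ⟨k, h⟩) else 0

theorem digit_of_lt (p : Preference X) {k : ℕ} (h : k < Fintype.card X) :
    p.digit k = height (p.nth ⟨k, h⟩) := dif_pos h

theorem digit_le_card (p : Preference X) (k : ℕ) : p.digit k ≤ Fintype.card X := by
  unfold digit
  split_ifs
  · exact height_le_card _
  · exact Nat.zero_le _

/-- A number encoding the first `k` alternatives, so that the order of the codes is the
lexicographic order. -/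
noncomputable def code (p : Preference X) : ℕ → ℕ
  | 0 => 0
  | k + 1 => code p k * (Fintype.card X + 1) + p.digit k

theorem code_succ (p : Preference X) (k : ℕ) :
    p.code (k + 1) = p.code k * (Fintype.card X + 1) + p.digit k := rfl

/-- Digits stay below the base `Fintype.card X + 1`, so a later digit cannot undo an earlier strict
inequality. -/
theorem code_succ_lt {p q : Preference X} {k : ℕ} (h : p.code k < q.code k) :
    p.code (k + 1) < q.code (k + 1) := by
  rw [code_succ, code_succ]
  have h1 := p.digit_le_card k
  have h2 : (p.code k + 1) * (Fintype.card X + 1) ≤ q.code k * (Fintype.card X + 1) :=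
    Nat.mul_le_mul_right _ h
  rw [Nat.add_mul] at h2
  omega

theorem code_lt_of_le {p q : Preference X} {k m : ℕ} (hkm : k ≤ m) (h : p.code k < q.code k) :
    p.code m < q.code m := by
  induction m, hkm using Nat.le_induction with
  | base => exact h
  | succ m _ ih => exact code_succ_lt ih

theorem code_eq_of_le {p q : Preference X} {k m : ℕ} (hkm : k ≤ m) (h : p.code m = q.code m) :
    p.code k = q.code k := by
  rcases lt_trichotomy (p.code k) (q.code k) with h1 | h1 | h1
  · exact absurd h (code_lt_of_le hkm h1).ne
  · exact h1
  · exact absurd h (code_lt_of_le hkm h1).ne'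

theorem code_succ_eq_iff (p q : Preference X) (k : ℕ) :
    p.code (k + 1) = q.code (k + 1) ↔ p.code k = q.code k ∧ p.digit k = q.digit k := by
  constructor
  · intro h
    have h1 := code_eq_of_le (Nat.le_succ k) h
    rw [code_succ, code_succ, h1] at h
    exact ⟨h1, by omega⟩
  · rintro ⟨h1, h2⟩
    rw [code_succ, code_succ, h1, h2]

theorem code_congr {p q : Preference X} {k : ℕ} (h : ∀ j < k, p.digit j = q.digit j) :
    p.code k = q.code k := by
  induction k with
  | zero => rfl
  | succ k ih =>
    exact (code_succ_eq_iff p q k).2 ⟨ih fun j hj => h j (by omega), h k (by omega)⟩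

theorem nth_eq_of_code_eq {p q : Preference X} {k : ℕ} (h : p.code k = q.code k)
    (j : Fin (Fintype.card X)) (hj : (j : ℕ) < k) : p.nth j = q.nth j := by
  have h1 := ((code_succ_eq_iff p q j).1 (code_eq_of_le hj h)).2
  rw [digit_of_lt _ j.2, digit_of_lt _ j.2] at h1
  exact height_strictMono.injective h1

theorem topSet_subset_of_code_eq {p q : Preference X} {k : ℕ} (h : p.code k = q.code k) :
    p.topSet k ⊆ q.topSet k := by
  intro x hx
  rw [mem_topSet] at hx ⊢
  have h1 := nth_eq_of_code_eq h ⟨p.rank x, p.rank_lt_card x⟩ hx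
  rw [nth_rank, eq_comm, nth_eq_iff] at h1
  rwa [h1]

theorem topSet_eq_of_code_eq {p q : Preference X} {k : ℕ} (h : p.code k = q.code k) :
    p.topSet k = q.topSet k :=
  (topSet_subset_of_code_eq h).antisymm (topSet_subset_of_code_eq h.symm)

theorem code_card_injective :
    Function.Injective fun p : Preference X => p.code (Fintype.card X) := by
  intro p q h
  refine ext_rank fun x => ?_
  have h1 := nth_eq_of_code_eq h ⟨p.rank x, p.rank_lt_card x⟩ (p.rank_lt_card x)
  rw [nth_rank, eq_comm, nth_eq_iff] at h1
  exact h1.symm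

theorem digit_splice_of_lt {p q : Preference X} {k j : ℕ} (hj : j < k) :
    (splice (p.topSet k) p q).digit j = p.digit j := by
  unfold digit
  split_ifs with h
  · rw [nth_splice_of_lt hj]
  · rfl

theorem digit_splice_of_le {p q : Preference X} {k j : ℕ} (h : p.topSet k = q.topSet k)
    (hj : k ≤ j) : (splice (p.topSet k) p q).digit j = q.digit j := by
  unfold digit
  split_ifs
  · rw [nth_splice_of_le h hj]
  · rfl

theorem code_splice (p q : Preference X) (k : ℕ) :
    (splice (p.topSet k) p q).code k = p.code k :=
  code_congr fun _ hj => digit_splice_of_lt hj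

/-- The splices exchange digits from `k` on, and the recursion for `code` is affine with a fixed
multiplier. -/
theorem code_splice_add {p q : Preference X} {k m : ℕ} (h : p.topSet k = q.topSet k)
    (hkm : k ≤ m) :
    (splice (p.topSet k) p q).code m + (splice (q.topSet k) q p).code m =
      p.code m + q.code m := by
  induction m, hkm using Nat.le_induction with
  | base => rw [code_splice, code_splice]
  | succ m hm ih =>
    simp only [code_succ]
    rw [digit_splice_of_le h hm, digit_splice_of_le h.symm hm]
    linear_combination (Fintype.card X + 1) * ih

/-- Exchanging the tails of a crossing pair increases the sum of the squared codes. -/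
theorem code_sq_lt_splice {p q : Preference X} {k : ℕ} (hk : k < Fintype.card X)
    (h : p.topSet k = q.topSet k) (hc : p.code k < q.code k) (hd : q.digit k < p.digit k) :
    p.code (Fintype.card X) ^ 2 + q.code (Fintype.card X) ^ 2 <
      (splice (p.topSet k) p q).code (Fintype.card X) ^ 2 +
        (splice (q.topSet k) q p).code (Fintype.card X) ^ 2 := by
  have h1 := code_splice_add h hk.le
  have h2 : (splice (p.topSet k) p q).code (Fintype.card X) < p.code (Fintype.card X) := by
    refine code_lt_of_le (Nat.succ_le_of_lt hk) ?_
    rw [Nat.succ_eq_add_one, code_succ, code_succ, code_splice, digit_splice_of_le h le_rfl]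
    omega
  have h3 : p.code (Fintype.card X) < q.code (Fintype.card X) := code_lt_of_le hk.le hc
  generalize (splice (p.topSet k) p q).code (Fintype.card X) = a at *
  generalize (splice (q.topSet k) q p).code (Fintype.card X) = b at *
  generalize p.code (Fintype.card X) = u at *
  generalize q.code (Fintype.card X) = w at *
  -- Here `a < u < w` and `a + b = u + w`: the outer pair has the same sum and a larger spread,
  -- hence a larger sum of squares.
  obtain ⟨s, rfl⟩ := Nat.exists_eq_add_of_lt h2
  obtain ⟨t, rfl⟩ := Nat.exists_eq_add_of_lt h3
  obtain rfl : b = a + s + 1 + t + 1 + s + 1 := by omega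
  nlinarith [Nat.zero_le (s * t), Nat.zero_le s, Nat.zero_le t, sq_nonneg s]

end Code

end Preference

/-! ### Swap-progressivity as a pairwise condition. -/

section Noncrossing

open Preference

variable {X : Type*} [Fintype X] [LinearOrder X]

/-- Whenever two preferences in the support reach the same top set, the one that is
lexicographically lower so far does not continue with a higher alternative. -/
def Noncrossing (μ : stdSimplex ℝ (Preference X)) : Prop :=
  ∀ p q : Preference X, μ p ≠ 0 → μ q ≠ 0 → ∀ k, p.topSet k = q.topSet k →
    p.code k < q.code k → p.digit k ≤ q.digit k

/-- While the prefixes agree, so do the top sets, and the hypothesis governs the next digit; after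
the first strict inequality the order is settled. -/
theorem code_le_code_of_compatible {p q : Preference X}
    (h : ∀ k : Fin (Fintype.card X), Compatible (k : ℕ) q p → p.nth k ≤ q.nth k) (k : ℕ) :
    p.code k ≤ q.code k := by
  induction k with
  | zero => exact le_rfl
  | succ k ih =>
    rcases ih.lt_or_eq with hlt | heq
    · exact (code_succ_lt hlt).le
    · rw [code_succ, code_succ, heq]
      refine Nat.add_le_add_left ?_ _
      unfold digit
      split_ifs with hk
      · exact height_strictMono.monotone (h ⟨k, hk⟩ (topSet_eq_of_code_eq heq).symm)
      · exact le_rfl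

theorem SwapProgressive.noncrossing {μ : stdSimplex ℝ (Preference X)} (h : SwapProgressive μ) :
    Noncrossing μ := by
  obtain ⟨N, e, ⟨-, hr⟩, he⟩ := h
  intro p q hp hq k hk hlt
  obtain ⟨i, rfl⟩ : p ∈ Set.range e := hr ▸ hp
  obtain ⟨j, rfl⟩ : q ∈ Set.range e := hr ▸ hq
  rcases lt_trichotomy i j with hij | rfl | hij
  · unfold digit
    split_ifs with hkn
    · exact height_strictMono.monotone (he j i hij ⟨k, hkn⟩ hk.symm)
    · exact le_rfl
  · exact le_rfl
  · exact absurd (code_le_code_of_compatible (he i j hij) k) (not_le.2 hlt)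

theorem Noncrossing.swapProgressive {μ : stdSimplex ℝ (Preference X)} (h : Noncrossing μ) :
    SwapProgressive μ := by
  classical
  let _ : LinearOrder (Preference X) :=
    -- The witnessing list is the support sorted lexicographically.
    LinearOrder.lift' (fun p : Preference X => p.code (Fintype.card X)) code_card_injective
  let S : Finset (Preference X) := Finset.univ.filter fun p => μ p ≠ 0
  have hS : ∀ i, μ (S.orderEmbOfFin rfl i) ≠ 0 := fun i =>
    (Finset.mem_filter.1 (S.orderEmbOfFin_mem rfl i)).2
  refine ⟨S.card, S.orderEmbOfFin rfl, ⟨(S.orderEmbOfFin rfl).injective, ?_⟩, ?_⟩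
  · rw [Finset.range_orderEmbOfFin]
    ext p
    simp [S]
  · intro i j hij k hk
    have hlt : (S.orderEmbOfFin rfl j).code (Fintype.card X) <
        (S.orderEmbOfFin rfl i).code (Fintype.card X) := (S.orderEmbOfFin rfl).strictMono hij
    have hi := hS i
    have hj := hS j
    generalize S.orderEmbOfFin rfl i = q at *
    generalize S.orderEmbOfFin rfl j = p at *
    by_contra! hn
    have hd : q.digit k < p.digit k := by
      rw [digit_of_lt _ k.2, digit_of_lt _ k.2]
      exact height_strictMono hn
    rcases lt_trichotomy (p.code k) (q.code k) with hc | hc | hc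
    · exact absurd (h p q hj hi k hk.symm hc) (not_le.2 hd)
    · refine lt_asymm hlt (code_lt_of_le (Nat.succ_le_of_lt k.2) ?_)
      rw [Nat.succ_eq_add_one, code_succ, code_succ, hc]
      omega
    · exact lt_asymm hlt (code_lt_of_le k.2.le hc)

theorem swapProgressive_iff_noncrossing {μ : stdSimplex ℝ (Preference X)} :
    SwapProgressive μ ↔ Noncrossing μ :=
  ⟨SwapProgressive.noncrossing, Noncrossing.swapProgressive⟩

end Noncrossing

/-! ### Existence by maximizing a convex functional. -/

section Existence

open Preference

/-- Moving mass from `p` and `q` to `p'` and `q'`. -/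
theorem exists_transfer {α : Type*} [Fintype α] (μ : stdSimplex ℝ α) {p q : α} (hpq : p ≠ q)
    (hp : μ p ≠ 0) (hq : μ q ≠ 0) (p' q' : α) :
    ∃ (ν : stdSimplex ℝ α) (ε : ℝ), 0 < ε ∧ ∀ f : α → ℝ,
      ∑ a, ν a * f a = ∑ a, μ a * f a + ε * (f p' + f q' - f p - f q) := by
  classical
  have hp0 : 0 < μ p := lt_of_le_of_ne (stdSimplex.zero_le μ p) hp.symm
  have hq0 : 0 < μ q := lt_of_le_of_ne (stdSimplex.zero_le μ q) hq.symm
  -- The largest amount that can be taken from both `p` and `q`; as they differ, neither is charged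
  -- twice.
  let ε := min (μ p) (μ q)
  let δ : α → α → ℝ := fun b a => if a = b then 1 else 0
  let w : α → ℝ := fun a => μ a + ε * (δ p' a + δ q' a - δ p a - δ q a)
  have hε : 0 < ε := lt_min hp0 hq0
  have hδ : ∀ (b : α) (f : α → ℝ), ∑ a, δ b a * f a = f b := by
    intro b f
    simp [δ]
  have hw : ∀ f : α → ℝ,
      ∑ a, w a * f a = ∑ a, μ a * f a + ε * (f p' + f q' - f p - f q) := by
    intro f
    rw [← hδ p' f, ← hδ q' f, ← hδ p f, ← hδ q f, ← Finset.sum_add_distrib,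
      ← Finset.sum_sub_distrib, ← Finset.sum_sub_distrib, Finset.mul_sum,
      ← Finset.sum_add_distrib]
    refine Finset.sum_congr rfl fun a _ => ?_
    simp only [w]
    ring
  have hδ0 : ∀ b a, 0 ≤ δ b a := by
    intro b a
    simp only [δ]
    split_ifs <;> norm_num
  refine ⟨⟨w, fun a => ?_, ?_⟩, ε, hε, hw⟩
  · have h1 := mul_nonneg hε.le (add_nonneg (hδ0 p' a) (hδ0 q' a))
    have h2 : ε * (δ p a + δ q a) ≤ μ a := by
      by_cases hap : a = p
      · subst hap
        have : δ q a = 0 := if_neg hpq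
        rw [this]
        have h4 : ε ≤ μ a := min_le_left _ _
        simpa [δ] using h4
      · have h3 : δ p a = 0 := if_neg hap
        by_cases haq : a = q
        · subst haq
          rw [h3]
          have h4 : ε ≤ μ a := min_le_right _ _
          simpa [δ] using h4
        · have h4 : δ q a = 0 := if_neg haq
          rw [h3, h4]
          simp
    simp only [w]
    linarith
  · have h1 := hw fun _ => 1
    have h2 : ∑ a, μ a = 1 := stdSimplex.sum_eq_one μ
    simp only [mul_one, h2] at h1
    rw [h1]
    ring

variable {X : Type*} [Fintype X]

open Classical in
theorem rationalizes_iff {μ : stdSimplex ℝ (Preference X)} {ρ : RandomChoiceRule X} :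
    Rationalizes μ ρ ↔ ∀ A : Menu X, ∀ x ∈ A.1,
      ρ.prob x A = ∑ p, μ p * if p.IsBest A.1 x then 1 else 0 := by
  simp only [Rationalizes, Finset.sum_filter, mul_ite, mul_one, mul_zero]

theorem isCompact_rationalizes (ρ : RandomChoiceRule X) :
    IsCompact {μ : stdSimplex ℝ (Preference X) | Rationalizes μ ρ} := by
  classical
  refine IsClosed.isCompact ?_
  have h : {μ : stdSimplex ℝ (Preference X) | Rationalizes μ ρ} =
      ⋂ A : Menu X, ⋂ x ∈ A.1, {μ | ρ.prob x A =
        ∑ p ∈ Finset.univ.filter (fun p : Preference X => p.IsBest A.1 x), μ.1 p} := by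
    ext μ
    simp only [Set.mem_iInter]
    exact Iff.rfl
  rw [h]
  refine isClosed_iInter fun A => isClosed_iInter fun x => isClosed_iInter fun _ => ?_
  exact isClosed_eq continuous_const
    (continuous_finsetSum _ fun p _ => (continuous_apply p).comp continuous_subtype_val)

variable [LinearOrder X]

theorem exists_swapProgressive {ρ : RandomChoiceRule X}
    (h : ∃ μ : stdSimplex ℝ (Preference X), Rationalizes μ ρ) :
    ∃ μ : stdSimplex ℝ (Preference X), Rationalizes μ ρ ∧ SwapProgressive μ := by
  classical
  let φ : Preference X → ℝ := fun p => ((p.code (Fintype.card X) ^ 2 : ℕ) : ℝ)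
  have hcont : Continuous fun μ : stdSimplex ℝ (Preference X) => ∑ p, μ.1 p * φ p :=
    continuous_finsetSum _ fun p _ =>
      ((continuous_apply p).comp continuous_subtype_val).mul continuous_const
  obtain ⟨μ, hμ, hmax⟩ := (isCompact_rationalizes ρ).exists_isMaxOn h hcont.continuousOn
  refine ⟨μ, hμ, swapProgressive_iff_noncrossing.2 ?_⟩
  intro p q hp hq k hk hc
  by_contra! hd
  -- Beyond the last position all digits are `0`, so a strict inequality of digits cannot occur
  -- there.
  have hkn : k < Fintype.card X := by
    by_contra hkn
    simp [digit, hkn] at hd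
  have hpq : p ≠ q := by
    rintro rfl
    exact lt_irrefl _ hc
  obtain ⟨ν, ε, hε, hν⟩ := exists_transfer μ hpq hp hq
    (splice (p.topSet k) p q) (splice (q.topSet k) q p)
  have hνρ : Rationalizes ν ρ := by
    rw [rationalizes_iff]
    intro A x hx
    rw [hν, ← rationalizes_iff.1 hμ A x hx]
    by_cases hxk : x ∈ p.topSet k
    · rw [isBest_splice_of_mem hxk, isBest_splice_of_mem (hk ▸ hxk)]
      ring
    · rw [isBest_splice_of_notMem hk hxk, isBest_splice_of_notMem hk.symm (hk ▸ hxk)]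
      ring
  have h1 : ∑ a, ν a * φ a ≤ ∑ a, μ a * φ a := hmax hνρ
  rw [hν] at h1
  have h2 : φ p + φ q < φ (splice (p.topSet k) p q) + φ (splice (q.topSet k) q p) := by
    simp only [φ]
    exact_mod_cast code_sq_lt_splice hkn hk hc hd
  have h3 := mul_pos hε (sub_pos.2 h2)
  linarith

end Existence

/-! ### Uniqueness by recovering the law of each prefix. -/

section Uniqueness

open Preference

section Mass

variable {α : Type*} [Fintype α]

open Classical in
/-- The probability of the event `P`. -/
noncomputable def mass (μ : stdSimplex ℝ α) (P : α → Prop) : ℝ :=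
  ∑ a ∈ Finset.univ.filter P, μ a

theorem mass_congr (μ : stdSimplex ℝ α) {P Q : α → Prop} (h : ∀ a, P a ↔ Q a) :
    mass μ P = mass μ Q := by
  rw [show P = Q from funext fun a => propext (h a)]

theorem mass_eq_zero (μ : stdSimplex ℝ α) {P : α → Prop} (h : ∀ a, ¬ P a) : mass μ P = 0 := by
  classical
  refine Finset.sum_eq_zero fun a ha => ?_
  exact absurd (Finset.mem_filter.1 ha).2 (h a)

theorem mass_mono (μ : stdSimplex ℝ α) {P Q : α → Prop} (h : ∀ a, P a → μ a ≠ 0 → Q a) :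
    mass μ P ≤ mass μ Q := by
  classical
  unfold mass
  rw [Finset.sum_filter, Finset.sum_filter]
  refine Finset.sum_le_sum fun a _ => ?_
  have h0 := stdSimplex.zero_le μ a
  by_cases ha : μ a = 0
  · simp [ha]
  · by_cases hP : P a
    · simp [hP, h a hP ha]
    · rw [if_neg hP]
      split_ifs
      · exact h0
      · exact le_rfl

/-- The hypothesis makes the two events nested on the support, so their intersection is the smaller
one. -/
theorem mass_and_eq_min (μ : stdSimplex ℝ α) {P Q : α → Prop}
    (h : ∀ a b, μ a ≠ 0 → μ b ≠ 0 → P a → ¬ Q a → Q b → P b) :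
    mass μ (fun a => P a ∧ Q a) = min (mass μ P) (mass μ Q) := by
  refine le_antisymm (le_min (mass_mono μ fun a ha _ => ha.1) (mass_mono μ fun a ha _ => ha.2)) ?_
  by_cases hP : ∃ a, μ a ≠ 0 ∧ P a ∧ ¬ Q a
  · obtain ⟨a, ha, haP, haQ⟩ := hP
    exact (min_le_right _ _).trans
      (mass_mono μ fun b hbQ hb => ⟨h a b ha hb haP haQ hbQ, hbQ⟩)
  · push Not at hP
    exact (min_le_left _ _).trans (mass_mono μ fun b hbP hb => ⟨hbP, hP b hb hbP⟩)

/-- Two distributions that agree on the fibres of `f` agree on events saturated for `f`. -/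
theorem mass_eq_of_fibers {μ ν : stdSimplex ℝ α} {β : Type*} (f : α → β) {P : α → Prop}
    (hP : ∀ a b, f a = f b → P a → P b)
    (h : ∀ a, P a → mass μ (fun b => f b = f a) = mass ν fun b => f b = f a) :
    mass μ P = mass ν P := by
  classical
  have key : ∀ κ : stdSimplex ℝ α, mass κ P =
      ∑ t ∈ (Finset.univ.filter P).image f, mass κ fun b => f b = t := by
    intro κ
    unfold mass
    rw [← Finset.sum_fiberwise_of_maps_to (g := f) (t := (Finset.univ.filter P).image f)
      fun a ha => Finset.mem_image_of_mem f ha]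
    refine Finset.sum_congr rfl fun t ht => ?_
    obtain ⟨a, ha, rfl⟩ := Finset.mem_image.1 ht
    refine Finset.sum_congr ?_ fun _ _ => rfl
    ext b
    simp only [Finset.mem_filter, Finset.mem_univ, true_and] at ha ⊢
    exact ⟨fun hb => hb.2, fun hb => ⟨hP a b hb.symm ha, hb⟩⟩
  rw [key, key]
  refine Finset.sum_congr rfl fun t ht => ?_
  obtain ⟨a, ha, rfl⟩ := Finset.mem_image.1 ht
  exact h a (Finset.mem_filter.1 ha).2

theorem mass_split (μ : stdSimplex ℝ α) (P Q : α → Prop) :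
    mass μ P = mass μ (fun a => P a ∧ Q a) + mass μ fun a => P a ∧ ¬ Q a := by
  classical
  unfold mass
  rw [← Finset.sum_filter_add_sum_filter_not (Finset.univ.filter P) Q, Finset.filter_filter,
    Finset.filter_filter]
  congr!

/-- The probability that two statistics take given values, by inclusion-exclusion from the
probabilities of the lower sets. -/
theorem mass_cell (μ : stdSimplex ℝ α) (P : α → Prop) (f g : α → ℕ) (s t : ℕ) :
    mass μ (fun a => P a ∧ f a = s ∧ g a = t) =
      mass μ (fun a => (P a ∧ f a < s + 1) ∧ P a ∧ g a < t + 1) -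
        mass μ (fun a => (P a ∧ f a < s) ∧ P a ∧ g a < t + 1) -
      (mass μ (fun a => (P a ∧ f a < s + 1) ∧ P a ∧ g a < t) -
        mass μ (fun a => (P a ∧ f a < s) ∧ P a ∧ g a < t)) := by
  have h : ∀ t, mass μ (fun a => (P a ∧ f a < s + 1) ∧ P a ∧ g a < t) -
      mass μ (fun a => (P a ∧ f a < s) ∧ P a ∧ g a < t) =
        mass μ fun a => P a ∧ f a = s ∧ g a < t := by
    intro t
    rw [mass_split μ (fun a => (P a ∧ f a < s + 1) ∧ P a ∧ g a < t) fun a => f a < s,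
      sub_eq_iff_eq_add, add_comm]
    congr 1
    · exact mass_congr μ fun a => ⟨fun ⟨⟨⟨h1, _⟩, _, h3⟩, h4⟩ => ⟨h1, by omega, h3⟩,
        fun ⟨h1, h2, h3⟩ => ⟨⟨⟨h1, by omega⟩, h1, h3⟩, by omega⟩⟩
    · exact mass_congr μ fun a => ⟨fun ⟨⟨⟨h1, _⟩, _, h3⟩, h4⟩ => ⟨⟨h1, h4⟩, h1, h3⟩,
        fun ⟨⟨h1, h2⟩, _, h3⟩ => ⟨⟨⟨h1, by omega⟩, h1, h3⟩, h2⟩⟩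
  rw [h, h, mass_split μ (fun a => P a ∧ f a = s ∧ g a < t + 1) fun a => g a < t,
    eq_sub_iff_add_eq, add_comm]
  congr 1
  · exact mass_congr μ fun a => ⟨fun ⟨h1, h2, h3⟩ => ⟨⟨h1, h2, by omega⟩, h3⟩,
      fun ⟨⟨h1, h2, _⟩, h3⟩ => ⟨h1, h2, h3⟩⟩
  · exact mass_congr μ fun a => ⟨fun ⟨h1, h2, h3⟩ => ⟨⟨h1, h2, by omega⟩, by omega⟩,
      fun ⟨⟨h1, h2, h3⟩, h4⟩ => ⟨h1, h2, by omega⟩⟩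

end Mass

variable {X : Type*} [Fintype X]

/-- The probability that `D` is exactly the set of alternatives better than `x` is determined by
the random choice rule. -/
theorem mass_topSet_rank_eq {μ ν : stdSimplex ℝ (Preference X)} {ρ : RandomChoiceRule X}
    (hμ : Rationalizes μ ρ) (hν : Rationalizes ν ρ) (x : X) (D : Finset X) :
    mass μ (fun p => p.topSet (p.rank x) = D) = mass ν fun p => p.topSet (p.rank x) = D := by
  classical
  induction D using Finset.strongInduction with
  | H D ih =>
    by_cases hx : x ∈ D
    · have h0 : ∀ p : Preference X, ¬ p.topSet (p.rank x) = D := by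
        rintro p rfl
        exact lt_irrefl _ ((p.mem_topSet _ _).1 hx)
      rw [mass_eq_zero μ h0, mass_eq_zero ν h0]
    · have hxD : x ∈ Dᶜ := Finset.mem_compl.2 hx
      -- Choice from `Dᶜ` reveals the total over all subsets of `D`; the induction hypothesis
      -- removes the proper ones.
      have hbest : ∀ p : Preference X, p.IsBest Dᶜ x ↔ p.topSet (p.rank x) ⊆ D := by
        intro p
        rw [isBest_iff]
        constructor
        · rintro ⟨-, h⟩ y hy
          by_contra hyD
          exact h y (Finset.mem_compl.2 hyD) hy
        · exact fun h => ⟨hxD, fun y hy hy' => Finset.mem_compl.1 hy (h hy')⟩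
      have htot : ∀ κ : stdSimplex ℝ (Preference X), Rationalizes κ ρ →
          mass κ (fun p => p.topSet (p.rank x) ⊆ D) = ρ.prob x ⟨Dᶜ, ⟨x, hxD⟩⟩ := by
        intro κ hκ
        rw [hκ ⟨Dᶜ, ⟨x, hxD⟩⟩ x hxD]
        refine (mass_congr κ fun p => (hbest p).symm).trans ?_
        unfold mass
        refine Finset.sum_congr ?_ fun _ _ => rfl
        ext p
        simp
      have hsub : mass μ (fun p => p.topSet (p.rank x) ⊂ D) =
          mass ν fun p => p.topSet (p.rank x) ⊂ D :=
        mass_eq_of_fibers (fun p : Preference X => p.topSet (p.rank x))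
          (fun a b hab ha => hab ▸ ha) fun a ha => ih _ ha
      have hsplit : ∀ κ : stdSimplex ℝ (Preference X),
          mass κ (fun p => p.topSet (p.rank x) ⊆ D) =
            mass κ (fun p => p.topSet (p.rank x) = D) +
              mass κ fun p => p.topSet (p.rank x) ⊂ D := by
        intro κ
        rw [mass_split κ _ fun p => p.topSet (p.rank x) = D]
        congr 1
        · exact mass_congr κ fun p => ⟨fun h => h.2, fun h => ⟨h.subset, h⟩⟩
        · exact mass_congr κ fun p =>
            ⟨fun h => h.1.ssubset_of_ne h.2, fun h => ⟨h.subset, h.ne⟩⟩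
      have h1 := hsplit μ
      have h2 := hsplit ν
      rw [htot μ hμ] at h1
      rw [htot ν hν] at h2
      linarith

variable [LinearOrder X]

theorem mass_topSet_digit_eq {μ ν : stdSimplex ℝ (Preference X)} {ρ : RandomChoiceRule X}
    (hμ : Rationalizes μ ρ) (hν : Rationalizes ν ρ) {k : ℕ} (hk : k < Fintype.card X)
    (D : Finset X) (d : ℕ) :
    mass μ (fun p => p.topSet k = D ∧ p.digit k < d) =
      mass ν fun p => p.topSet k = D ∧ p.digit k < d := by
  refine mass_eq_of_fibers (fun p : Preference X => (p.topSet k, p.digit k)) ?_ ?_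
  · intro a b hab ha
    rw [Prod.mk.injEq] at hab
    rwa [← hab.1, ← hab.2]
  · intro a _
    have h : ∀ p : Preference X, (p.topSet k, p.digit k) = (a.topSet k, a.digit k) ↔
        p.topSet (p.rank (a.nth ⟨k, hk⟩)) = a.topSet k := by
      intro p
      rw [Prod.mk.injEq, p.topSet_rank_eq_iff a ⟨k, hk⟩, digit_of_lt _ hk, digit_of_lt _ hk,
        height_strictMono.injective.eq_iff]
    rw [mass_congr μ h, mass_congr ν h]
    exact mass_topSet_rank_eq hμ hν _ _

/-- Comonotonicity of prefix and next digit, given the top set: lower sets of the two are nested on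
the support. -/
theorem Noncrossing.mass_and_eq_min {μ : stdSimplex ℝ (Preference X)} (h : Noncrossing μ)
    (k : ℕ) (D : Finset X) (s t : ℕ) :
    mass μ (fun p => (p.topSet k = D ∧ p.code k < s) ∧ p.topSet k = D ∧ p.digit k < t) =
      min (mass μ fun p => p.topSet k = D ∧ p.code k < s)
        (mass μ fun p => p.topSet k = D ∧ p.digit k < t) := by
  refine _root_.mass_and_eq_min μ ?_
  rintro p q hp hq ⟨hpD, hps⟩ hpt ⟨hqD, hqt⟩
  refine ⟨hqD, ?_⟩
  by_contra! hqs
  have h1 := h p q hp hq k (hpD.trans hqD.symm) (by omega)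
  exact hpt ⟨hpD, by omega⟩

theorem mass_code_eq {μ ν : stdSimplex ℝ (Preference X)} {ρ : RandomChoiceRule X}
    (hμ : Rationalizes μ ρ) (hν : Rationalizes ν ρ) (hμn : Noncrossing μ) (hνn : Noncrossing ν)
    {k : ℕ} (hk : k ≤ Fintype.card X) (p : Preference X) :
    mass μ (fun q => q.code k = p.code k) = mass ν fun q => q.code k = p.code k := by
  induction k generalizing p with
  | zero =>
    have h : ∀ κ : stdSimplex ℝ (Preference X),
        mass κ (fun q => q.code 0 = p.code 0) = 1 := by
      intro κ
      rw [← stdSimplex.sum_eq_one κ]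
      simp [mass, code]
    rw [h, h]
  | succ k ih =>
    -- The prefix code determines the top set, so this event is a union of fibres covered by the
    -- induction hypothesis.
    have hlow : ∀ s, mass μ (fun q => q.topSet k = p.topSet k ∧ q.code k < s) =
        mass ν fun q => q.topSet k = p.topSet k ∧ q.code k < s := fun s =>
      mass_eq_of_fibers (fun q : Preference X => q.code k)
        (fun a b hab ha => ⟨(topSet_eq_of_code_eq hab).symm.trans ha.1, hab ▸ ha.2⟩)
        fun a _ => ih (by omega) a
    have hJ : ∀ s t, mass μ (fun q => (q.topSet k = p.topSet k ∧ q.code k < s) ∧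
          q.topSet k = p.topSet k ∧ q.digit k < t) =
        mass ν (fun q => (q.topSet k = p.topSet k ∧ q.code k < s) ∧
          q.topSet k = p.topSet k ∧ q.digit k < t) := by
      intro s t
      rw [hμn.mass_and_eq_min, hνn.mass_and_eq_min, hlow,
        mass_topSet_digit_eq hμ hν (by omega)]
    have hcell : ∀ q : Preference X, q.code (k + 1) = p.code (k + 1) ↔
        q.topSet k = p.topSet k ∧ q.code k = p.code k ∧ q.digit k = p.digit k := by
      intro q
      rw [code_succ_eq_iff]
      exact ⟨fun h => ⟨topSet_eq_of_code_eq h.1, h⟩, fun h => h.2⟩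
    rw [mass_congr μ hcell, mass_congr ν hcell, mass_cell, mass_cell]
    simp only [hJ]

theorem eq_of_swapProgressive {μ ν : stdSimplex ℝ (Preference X)} {ρ : RandomChoiceRule X}
    (hμ : Rationalizes μ ρ) (hμs : SwapProgressive μ) (hν : Rationalizes ν ρ)
    (hνs : SwapProgressive ν) : μ = ν := by
  classical
  refine stdSimplex.ext (funext fun p => ?_)
  have h := mass_code_eq hμ hν hμs.noncrossing hνs.noncrossing le_rfl p
  have hpoint : ∀ κ : stdSimplex ℝ (Preference X),
      mass κ (fun q => q.code (Fintype.card X) = p.code (Fintype.card X)) = κ p := by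
    intro κ
    rw [mass_congr κ fun q => code_card_injective.eq_iff]
    unfold mass
    rw [Finset.sum_filter]
    simp
  rwa [hpoint, hpoint] at h

end Uniqueness

/-! ### Single-crossing, progressive and swap-progressive distributions. -/

section SingleCrossing

open Preference

variable {X : Type*} [Fintype X]

theorem inducedChoice_toChoice (μ : stdSimplex ℝ (Preference X)) (p : Preference X) :
    inducedChoice μ p.toChoice = μ p := by
  classical
  unfold inducedChoice
  rw [stdSimplex.map_coe, FunOnFinite.linearMap_apply_apply]
  rw [Finset.sum_eq_single p]
  · intro q hq hne
    exact absurd (toChoice_injective (by simpa using hq)) hne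
  · intro h
    simp at h

theorem exists_of_inducedChoice_ne_zero {μ : stdSimplex ℝ (Preference X)} {c : ChoiceFunction X}
    (h : inducedChoice μ c ≠ 0) : ∃ p : Preference X, μ p ≠ 0 ∧ p.toChoice = c := by
  classical
  unfold inducedChoice at h
  rw [stdSimplex.map_coe, FunOnFinite.linearMap_apply_apply] at h
  obtain ⟨p, hp, hp0⟩ := Finset.exists_ne_zero_of_sum_ne_zero h
  exact ⟨p, hp0, by simpa using hp⟩

theorem listsSupport_toChoice_comp_iff {μ : stdSimplex ℝ (Preference X)} {N : ℕ}
    {e : Fin N → Preference X} :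
    ListsSupport (inducedChoice μ) (toChoice ∘ e) ↔ ListsSupport μ e := by
  unfold ListsSupport
  refine and_congr (toChoice_injective.of_comp_iff e) ?_
  have h : {c | inducedChoice μ c ≠ 0} = toChoice '' {p | μ p ≠ 0} := by
    ext c
    constructor
    · exact exists_of_inducedChoice_ne_zero
    · rintro ⟨p, hp, rfl⟩
      rw [Set.mem_ofPred_eq, inducedChoice_toChoice]
      exact hp
  rw [h, Set.range_comp]
  exact toChoice_injective.image_injective.eq_iff

variable [LinearOrder X]

/-- If `q` chose lower than `p` from a menu, the two chosen elements would violate single-crossing;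
conversely, menus `pair x y` suffice. -/
theorem single_crossing_iff_toChoice_le (p q : Preference X) :
    (∀ x y : X, y ≤ x → p.rel x y → q.rel x y) ↔
      ∀ A : Menu X, p.toChoice.1 A ≤ q.toChoice.1 A := by
  constructor
  · intro h A
    by_contra! hlt
    have hp := p.isBest_toChoice A
    have hq := q.isBest_toChoice A
    have h1 := h _ _ hlt.le (hp.2 _ hq.1)
    exact hlt.ne (q.antisymm _ _ (hq.2 _ hp.1) h1)
  · intro h x y hyx hxy
    have h1 := h (pair x y)
    rw [(toChoice_pair_eq_left_iff p x y).2 hxy] at h1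
    rw [← toChoice_pair_eq_left_iff]
    rcases q.toChoice_pair_eq_or x y with h2 | h2
    · exact h2
    · rw [h2] at h1 ⊢
      exact hyx.antisymm h1

theorem singleCrossing_iff_progressive (μ : stdSimplex ℝ (Preference X)) :
    SingleCrossing μ ↔ Progressive (inducedChoice μ) := by
  constructor
  · rintro ⟨N, e, he, h⟩
    exact ⟨N, toChoice ∘ e, listsSupport_toChoice_comp_iff.2 he, fun i j hij =>
      (single_crossing_iff_toChoice_le _ _).1 (h i j hij)⟩
  · rintro ⟨N, c, hc, h⟩
    have hex : ∀ i, ∃ p : Preference X, p.toChoice = c i := fun i =>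
      (exists_of_inducedChoice_ne_zero (hc.2.subset ⟨i, rfl⟩)).imp fun _ hp => hp.2
    choose e he using hex
    obtain rfl : toChoice ∘ e = c := funext he
    exact ⟨N, e, listsSupport_toChoice_comp_iff.1 hc, fun i j hij =>
      (single_crossing_iff_toChoice_le _ _).2 (h i j hij)⟩

theorem SingleCrossing.swapProgressive {μ : stdSimplex ℝ (Preference X)} (h : SingleCrossing μ) :
    SwapProgressive μ := by
  obtain ⟨N, e, he, h⟩ := h
  refine ⟨N, e, he, fun i j hij k hk => ?_⟩
  by_contra! hlt
  -- Neither next alternative lies in the common top set, so each preference puts its own first. If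
  -- the later one were lower, single-crossing would reverse the later preference.
  have hbest : ∀ (p q : Preference X), p.topSet k = q.topSet k → p.rel (p.nth k) (q.nth k) := by
    intro p q hpq
    rw [rel_iff_rank_le, rank_nth]
    by_contra! hr
    rw [← mem_topSet, hpq, mem_topSet, rank_nth] at hr
    exact lt_irrefl _ hr
  have h1 := h i j hij _ _ hlt.le (hbest _ _ hk.symm)
  exact hlt.ne ((e i).antisymm _ _ (hbest _ _ hk) h1)

end SingleCrossing

theorem theorem3 {X : Type*} [Fintype X] [LinearOrder X] :
    (∀ ρ : RandomChoiceRule X,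
      ((∃ μ : stdSimplex ℝ (Preference X), Rationalizes μ ρ ∧ SwapProgressive μ) ↔
        ∃ μ : stdSimplex ℝ (Preference X), Rationalizes μ ρ) ∧
      ∀ μ ν : stdSimplex ℝ (Preference X),
        Rationalizes μ ρ → SwapProgressive μ → Rationalizes ν ρ → SwapProgressive ν → μ = ν) ∧
    (∀ μ : stdSimplex ℝ (Preference X), SingleCrossing μ → SwapProgressive μ) ∧
    (∀ μ : stdSimplex ℝ (Preference X), SwapProgressive μ →
      (SingleCrossing μ ↔ Progressive (inducedChoice μ))) :=
  ⟨fun _ => ⟨⟨fun ⟨μ, hμ, _⟩ => ⟨μ, hμ⟩, exists_swapProgressive⟩,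
    fun _ _ hμ hμs hν hνs => eq_of_swapProgressive hμ hμs hν hνs⟩,
    fun _ h => h.swapProgressive, fun μ _ => singleCrossing_iff_progressive μ⟩
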